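/- Let $N\ge 0$ and let $P=(P_1,\dots,P_N)$ be an $N$-tuple of polynomials in $\mathbb{C}[x_1,\dots,x_N]$. For $n\ge 0$ let $\mathcal{C}_n$ be the set of $N$-tuples $X=(X_1,\dots,X_N)$ of pairwise commuting $n\times n$ complex matrices; $P$ acts on $\mathcal{C}_n$ by $P(X)=(P_1(X),\dots,P_N(X))$. For $X\in\mathcal{C}_n$ let $T_X$ be the space of all $N$-tuples $H$ of $n\times n$ matrices for which the tuple $\begin{pmatrix}X&H\\0&X\end{pmatrix}:=\left(\begin{pmatrix}X_i&H_i\\0&X_i\end{pmatrix}\right)_{i=1}^N$ lies in $\mathcal{C}_{2n}$, and for $H\in T_X$ define $DP(X)[H]$ as the upper right block of $P\begin{pmatrix}X&H\\0&X\end{pmatrix}=\begin{pmatrix}P(X)&DP(X)[H]\\0&P(X)\end{pmatrix}$. The following are equivalent: 1. $DP(X)$ is nonsingular at every commuting tuple $X$: for all $n$, all $X\in\mathcal{C}_n$ and all $H\in T_X$, $DP(X)[H]=0$ implies $H=0$. 2. For all $n$ and all $X\in\mathcal{C}_n$, $DP(X)$ is a bijection from $T_X$ onto $T_{P(X)}$.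 3. $P:\mathcal{C}_n\to\mathcal{C}_n$ is injective for every $n$. 4. $P:\mathcal{C}_n\to\mathcal{C}_n$ is bijective for every $n$. 5. $P$ has a polynomial inverse on commuting tuples: there is a single $N$-tuple $Q$ of polynomials in $\mathbb{C}[x_1,\dots,x_N]$ with $Q(P(X))=X$ and $P(Q(X))=X$ for all $n$ and all $X\in\mathcal{C}_n$. 6. $P:\mathbb{C}^N\to\mathbb{C}^N$ is injective. 7. $P:\mathbb{C}^N\to\mathbb{C}^N$ is bijective. 8. $P:\mathbb{C}^N\to\mathbb{C}^N$ has an inverse given by a polynomial map. -/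

import Mathlib

/-- The commuting `N`-tuples of `m × m` complex matrices. -/
def commTuples (N : ℕ) (m : Type*) [Fintype m] : Set (Fin N → Matrix m m ℂ) :=
  {X | ∀ i j, X i * X j = X j * X i}

/-- The value of the commutative polynomial `p` at a matrix tuple `X`: each monomial `s` is replaced
by the product of the powers `X i ^ s i`. The factors are written in increasing order of `i`; on
commuting tuples, the only place where this is used, the order is irrelevant. -/
noncomputable def matEval {N : ℕ} {m : Type*} [Fintype m] [DecidableEq m]
    (p : MvPolynomial (Fin N) ℂ) (X : Fin N → Matrix m m ℂ) : Matrix m m ℂ :=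
  ∑ s ∈ p.support, p.coeff s • (List.ofFn fun i => X i ^ s i).prod

/-- The polynomial map `P` evaluated at a tuple of matrices. -/
noncomputable def matMap {N : ℕ} {m : Type*} [Fintype m] [DecidableEq m]
    (P : Fin N → MvPolynomial (Fin N) ℂ) (X : Fin N → Matrix m m ℂ) : Fin N → Matrix m m ℂ :=
  fun k => matEval (P k) X

/-- The polynomial map `ℂ^N → ℂ^N` on scalars. -/
noncomputable def scalarMap {N : ℕ} (P : Fin N → MvPolynomial (Fin N) ℂ) (x : Fin N → ℂ) :
    Fin N → ℂ :=
  fun k => MvPolynomial.eval x (P k)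

/-- The tuple of block matrices `[X H; 0 X]`. -/
def blockTuple {N : ℕ} {m : Type*} (X H : Fin N → Matrix m m ℂ) :
    Fin N → Matrix (m ⊕ m) (m ⊕ m) ℂ :=
  fun i => Matrix.fromBlocks (X i) (H i) 0 (X i)

/-- The directions `H` in which a map on commuting tuples can be differentiated at `X`:
those for which the tuple `[X H; 0 X]` is again commuting. -/
def tangentDirs {N : ℕ} {m : Type*} [Fintype m] (X : Fin N → Matrix m m ℂ) :
    Set (Fin N → Matrix m m ℂ) :=
  {H | blockTuple X H ∈ commTuples N (m ⊕ m)}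

/-- The derivative `DP(X)[H]` of free analysis: the upper right block of the value of `P` at
`[X H; 0 X]`. -/
noncomputable def freeDeriv {N : ℕ} {m : Type*} [Fintype m] [DecidableEq m]
    (P : Fin N → MvPolynomial (Fin N) ℂ) (X H : Fin N → Matrix m m ℂ) : Fin N → Matrix m m ℂ :=
  fun k => (matMap P (blockTuple X H) k).toBlocks₁₂

/-! Everything reduces to points of `ℂ^N`. A polynomial inverse `Q` there gives a polynomial
identity, which evaluation, a homomorphism on commuting tuples, carries to matrices of every size.
Block tuples commute too, so the same identity on them is the chain rule. Conversely, if `P(x) =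
P(y)`, then `DP` at `diag(x, y)` kills the direction `(x - y) E₁₂`, so nonsingularity forces `x =
y`.

The core is that an injective `P` has a polynomial inverse. By Ax–Grothendieck `P` is surjective.
Over a generic `y`, lying over realizes every root of the minimal equation of a coordinate `t` over
`K[P]` as a value of `t` on the fibre. The fibre is one point, so in characteristic zero the sum of
the roots makes `t` rational in `P`. Surjectivity and the Nullstellensatz then remove the
denominator. -/

/-! ### Ring-theoretic preliminaries -/

/-- Lying over for a ring homomorphism `f` to a polynomial ring, at a prime at which the variables
become integral. -/
theorem MvPolynomial.exists_isPrime_comap_eq {R k σ : Type*} [CommRing R] [CommRing k]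
    (f : R →+* MvPolynomial σ k) (hC : ∀ a, MvPolynomial.C a ∈ f.range)
    (p : Ideal R) [p.IsPrime] (hker : RingHom.ker f ≤ p)
    (hX : ∀ j, ∃ c : Polynomial R, c.eval₂ f (MvPolynomial.X j) = 0 ∧ c.leadingCoeff ∉ p) :
    ∃ q : Ideal (MvPolynomial σ k), q.IsPrime ∧ q.comap f = p := by
  let S := MvPolynomial σ k
  let M := p.primeCompl
  let Rm := Localization.AtPrime p
  let Sm := Localization (M.map f)
  let φ : Rm →+* Sm := IsLocalization.map Sm f M.le_comap_map
  let _ : Algebra Rm Sm := φ.toAlgebra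
  have hcomp (r : R) : φ (algebraMap R Rm r) = algebraMap S Sm (f r) := IsLocalization.map_eq _ r
  -- After localizing at `p` the leading coefficients are units, so the variables are integral.
  have hint (b : S) : IsIntegral Rm (algebraMap S Sm b) := by
    induction b using MvPolynomial.induction_on with
    | C a =>
      obtain ⟨r, hr⟩ := hC a
      rw [← hr, ← hcomp]
      exact isIntegral_algebraMap
    | add a b ha hb => rw [map_add]; exact ha.add hb
    | mul_X a j ha =>
      rw [map_mul]
      refine ha.mul ?_
      obtain ⟨c, hc, hcM⟩ := hX j
      exact f.isIntegralElem_localization_at_leadingCoeff _ c hc M hcM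
  have : Nontrivial Sm := by
    rw [← not_subsingleton_iff_nontrivial, IsLocalization.subsingleton_iff (M := M.map f)]
    rintro ⟨r, hr, h0⟩
    exact hr (hker h0)
  let B := integralClosure Rm Sm
  let ι : S →+* B := (algebraMap S Sm).codRestrict B.toSubring hint
  have hι (r : R) : ι (f r) = algebraMap Rm B (algebraMap R Rm r) := Subtype.ext (hcomp r).symm
  obtain ⟨Q, -, hQ, hQc⟩ := Ideal.exists_ideal_over_prime_of_isIntegral
    (IsLocalRing.maximalIdeal Rm) (⊥ : Ideal B)
    (IsLocalRing.le_maximalIdeal (Ideal.comap_ne_top _ bot_ne_top))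
  refine ⟨Q.comap ι, inferInstance, ?_⟩
  ext r
  rw [Ideal.mem_comap, Ideal.mem_comap, hι, ← Ideal.mem_comap, hQc,
    IsLocalization.AtPrime.to_map_mem_maximal_iff Rm p]

/-- If `m` has least degree among the nonzero polynomials killed by `f`, then a homomorphism
that kills `m` but not its leading coefficient kills all of `ker f`. -/
theorem Polynomial.ker_le_ker_of_natDegree_le {A B K : Type*} [CommRing A] [CommRing B]
    [CommRing K] [IsDomain K] (f : Polynomial A →+* B) (e : Polynomial A →+* K) (m : Polynomial A)
    (hm : f m = 0) (hmin : ∀ r ≠ 0, f r = 0 → m.natDegree ≤ r.natDegree)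
    (hem : e m = 0) (hlc : e (Polynomial.C m.leadingCoeff) ≠ 0) :
    RingHom.ker f ≤ RingHom.ker e := by
  intro r hr
  rw [RingHom.mem_ker] at hr ⊢
  by_cases hm0 : m.natDegree = 0
  · rw [Polynomial.eq_C_of_natDegree_eq_zero hm0, Polynomial.leadingCoeff_C,
      ← Polynomial.eq_C_of_natDegree_eq_zero hm0] at hlc
    exact absurd hem hlc
  induction h : r.natDegree using Nat.strong_induction_on generalizing r with
  | _ n ih =>
    by_cases hr0 : r = 0
    · simp [hr0]
    have hle := hmin r hr0 hr
    -- One step of pseudo-division by `m`: the degree drops and `s` stays in the kernel.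
    set s := Polynomial.C m.leadingCoeff * r -
      Polynomial.C r.leadingCoeff * Polynomial.X ^ (r.natDegree - m.natDegree) * m with hs
    have hfs : f s = 0 := by simp [hs, hr, hm]
    have hdeg : s.natDegree < n := by
      have h1 : s.natDegree ≤ n := by
        refine (Polynomial.natDegree_sub_le _ _).trans (max_le ?_ ?_)
        · exact (Polynomial.natDegree_C_mul_le _ _).trans h.le
        · refine Polynomial.natDegree_mul_le.trans ?_
          have := Polynomial.natDegree_C_mul_X_pow_le r.leadingCoeff (r.natDegree - m.natDegree)
          omega
      refine lt_of_le_of_ne h1 fun h2 => ?_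
      have h3 : s.coeff n = 0 := by
        have h4 : (Polynomial.X ^ (r.natDegree - m.natDegree) * m).coeff n = m.leadingCoeff := by
          rw [Polynomial.coeff_X_pow_mul', if_pos (by omega), Polynomial.leadingCoeff]
          congr 1
          omega
        rw [hs, Polynomial.coeff_sub, mul_assoc, Polynomial.coeff_C_mul, Polynomial.coeff_C_mul, h4,
          ← h, Polynomial.coeff_natDegree, mul_comm, sub_self]
      rw [← h2, Polynomial.coeff_natDegree, Polynomial.leadingCoeff_eq_zero] at h3
      rw [h3, Polynomial.natDegree_zero] at h2
      omega
    have hes := ih _ hdeg hfs rfl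
    rw [hs] at hes
    simpa [hem, hlc] using hes

/-- Here `m` is a constant times `(X - τ) ^ d`. -/
theorem Polynomial.coeff_of_roots_eq {K : Type*} [Field K] [IsAlgClosed K] (m : Polynomial K)
    (τ : K) (h : ∀ z, m.eval z = 0 → z = τ) (hm : 0 < m.natDegree) :
    m.coeff (m.natDegree - 1) = - (m.natDegree * m.leadingCoeff * τ) := by
  have hs := IsAlgClosed.splits m
  have hcard := hs.natDegree_eq_card_roots
  have hr : m.roots = Multiset.replicate m.natDegree τ := by
    rw [Multiset.eq_replicate]
    exact ⟨hcard.symm, fun z hz => h z (Polynomial.isRoot_of_mem_roots hz)⟩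
  have he := hs.eq_prod_roots
  rw [hr, Multiset.map_replicate, Multiset.prod_replicate] at he
  have hc := congrArg (fun q => q.coeff (m.natDegree - 1)) he
  have hch : m.natDegree.choose (m.natDegree - 1) = m.natDegree := by
    rw [Nat.choose_symm_of_eq_add (b := 1) (by omega), Nat.choose_one_right]
  simp only [Polynomial.coeff_C_mul, sub_eq_add_neg, ← Polynomial.C_neg,
    Polynomial.coeff_X_add_C_pow, hch, Nat.sub_sub_self hm] at hc
  rw [hc]
  ring

/-! ### Polynomial inverses of injective polynomial maps -/

namespace MvPolynomial

variable {K σ : Type*} [Field K]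

theorem eval_aeval (P : σ → MvPolynomial σ K) (x : σ → K) (a : MvPolynomial σ K) :
    eval x (aeval P a) = eval (fun k => eval x (P k)) a := by
  induction a using MvPolynomial.induction_on <;> simp_all

theorem aeval_injective_of_surjective [Infinite K] (P : σ → MvPolynomial σ K)
    (hs : Function.Surjective fun (x : σ → K) k => eval x (P k)) :
    Function.Injective (aeval (R := K) P) := by
  rw [injective_iff_map_eq_zero]
  intro a ha
  refine MvPolynomial.funext fun y => ?_
  obtain ⟨x, rfl⟩ := hs y
  rw [← eval_aeval, ha, map_zero, map_zero]

theorem exists_polynomial_eval₂_eq_zero [Finite σ] (P : σ → MvPolynomial σ K)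
    (hP : AlgebraicIndependent K P) (t : MvPolynomial σ K) :
    ∃ c : Polynomial (MvPolynomial σ K), c ≠ 0 ∧ c.eval₂ (aeval P).toRingHom t = 0 := by
  have hb : IsTranscendenceBasis K P :=
    hP.isTranscendenceBasis_of_lift_trdeg_le_of_finite (by rw [trdeg_of_isDomain]; simp)
  have := hb.isAlgebraic
  obtain ⟨c, hc0, hc⟩ := Algebra.IsAlgebraic.isAlgebraic (R := Algebra.adjoin K (Set.range P)) t
  let ε := hP.aevalEquiv
  refine ⟨c.map ε.symm.toRingEquiv.toRingHom, ?_, ?_⟩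
  · exact (Polynomial.map_ne_zero_iff ε.symm.injective).2 hc0
  · rw [Polynomial.eval₂_map, ← hc, Polynomial.aeval_def]
    congr 1
    ext a
    have := hP.algebraMap_aevalEquiv (ε.symm a)
    simp only [ε, AlgEquiv.apply_symm_apply] at this
    rw [this]
    rfl

/-- Injectivity makes `t` a rational function of `P`. -/
theorem exists_mul_aeval_eq_aeval_of_injective [Finite σ] [IsAlgClosed K] [CharZero K]
    (P : σ → MvPolynomial σ K) (hP : AlgebraicIndependent K P)
    (hi : Function.Injective fun (x : σ → K) k => eval x (P k)) (t : MvPolynomial σ K) :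
    ∃ u v : MvPolynomial σ K, u ≠ 0 ∧ t * aeval P u = aeval P v := by
  classical
  have := Fintype.ofFinite σ
  let φ : MvPolynomial σ K →+* MvPolynomial σ K := (aeval P).toRingHom
  have hφ : Function.Injective φ := hP
  let f : Polynomial (MvPolynomial σ K) →+* MvPolynomial σ K := Polynomial.eval₂RingHom φ t
  have hex : ∃ d, ∃ m : Polynomial (MvPolynomial σ K), m ≠ 0 ∧ f m = 0 ∧ m.natDegree = d := by
    obtain ⟨c, hc0, hc⟩ := exists_polynomial_eval₂_eq_zero P hP t
    exact ⟨_, c, hc0, hc, rfl⟩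
  obtain ⟨m, hm0, hm, hmd⟩ := Nat.find_spec hex
  have hmin : ∀ r ≠ 0, f r = 0 → m.natDegree ≤ r.natDegree := fun r hr hfr =>
    hmd.le.trans (Nat.find_min' hex ⟨r, hr, hfr, rfl⟩)
  have hpos : 0 < m.natDegree := by
    rw [Nat.pos_iff_ne_zero]
    intro h0
    rw [Polynomial.eq_C_of_natDegree_eq_zero h0] at hm hm0
    have : φ (m.coeff 0) = 0 := by simpa [f] using hm
    exact hm0 (by rw [(map_eq_zero_iff φ hφ).1 this, Polynomial.C_0])
  choose c hc0 hc using fun j => exists_polynomial_eval₂_eq_zero P hP (X j)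
  -- Off the zeros of `g`, no leading coefficient degenerates.
  let g := m.leadingCoeff * ∏ j, (c j).leadingCoeff
  have hg : g ≠ 0 := mul_ne_zero (Polynomial.leadingCoeff_ne_zero.2 hm0)
    (Finset.prod_ne_zero_iff.2 fun j _ => Polynomial.leadingCoeff_ne_zero.2 (hc0 j))
  have hlift (y : σ → K) (hy : eval y g ≠ 0) (z : K) (hz : (m.map (eval y)).eval z = 0) :
      ∃ x : σ → K, (fun k => eval x (P k)) = y ∧ eval x t = z := by
    let e : Polynomial (MvPolynomial σ K) →+* K := Polynomial.eval₂RingHom (eval y) z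
    have heC (a) : e (Polynomial.C a) = eval y a := by simp [e]
    have hyl : eval y m.leadingCoeff ≠ 0 := by
      rw [map_mul] at hy; exact left_ne_zero_of_mul hy
    have hyc (j) : eval y (c j).leadingCoeff ≠ 0 := by
      rw [map_mul, map_prod] at hy
      exact Finset.prod_ne_zero_iff.1 (right_ne_zero_of_mul hy) j (Finset.mem_univ j)
    have hker : RingHom.ker f ≤ RingHom.ker e :=
      Polynomial.ker_le_ker_of_natDegree_le f e m hm hmin
        (by rw [Polynomial.eval_map] at hz; exact hz) (by rwa [heC])
    have := RingHom.ker_isPrime e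
    obtain ⟨q, hq, hqc⟩ := exists_isPrime_comap_eq f
      (fun a => ⟨Polynomial.C (C a), by simp [f, φ]⟩) (RingHom.ker e) hker fun j => by
        refine ⟨(c j).map Polynomial.C, ?_, ?_⟩
        · rw [Polynomial.eval₂_map, ← hc j]
          congr 1
          ext a <;> simp [f, φ]
        · rw [Polynomial.leadingCoeff_map_of_injective Polynomial.C_injective, RingHom.mem_ker, heC]
          exact hyc j
    -- By the Nullstellensatz, a maximal ideal over `q` is a point `x`, the one sought.
    obtain ⟨n, hn, hqn⟩ := Ideal.exists_le_maximal q hq.ne_top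
    obtain ⟨x, rfl⟩ := isMaximal_iff_eq_vanishingIdeal_singleton.1 hn
    have hmem (r) (hr : e r = 0) : eval x (f r) = 0 := by
      have h1 : f r ∈ q := by
        rw [← Ideal.mem_comap, hqc]; exact hr
      have h2 := (mem_vanishingIdeal_singleton_iff x _).1 (hqn h1)
      rwa [aeval_eq_eval] at h2
    refine ⟨x, ?_, ?_⟩
    · ext k
      have := hmem (Polynomial.C (X k - C (y k))) (by simp [heC])
      simpa [f, φ, sub_eq_zero] using this
    · have := hmem (Polynomial.X - Polynomial.C (C z)) (by simp [e])
      simpa [f, φ, sub_eq_zero] using this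
  -- All `d` roots equal `t`, so `d * t` is their sum; characteristic zero keeps `u` nonzero.
  refine ⟨m.natDegree * m.leadingCoeff, - m.coeff (m.natDegree - 1), mul_ne_zero
    (by exact_mod_cast hpos.ne') (Polynomial.leadingCoeff_ne_zero.2 hm0), ?_⟩
  -- The factor `g(P)` makes the identity trivial where `g(P)` vanishes.
  have hφg : aeval P g ≠ 0 := (map_ne_zero_iff φ hφ).2 hg
  refine mul_right_cancel₀ hφg (MvPolynomial.funext fun x => ?_)
  simp only [map_mul, eval_aeval P x]
  set y := fun k => eval x (P k) with hy
  by_cases h0 : eval y g = 0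
  · rw [h0, mul_zero, mul_zero]
  have hyl : eval y m.leadingCoeff ≠ 0 := by
    rw [map_mul] at h0; exact left_ne_zero_of_mul h0
  have hd := Polynomial.natDegree_map_of_leadingCoeff_ne_zero (eval y) hyl
  have key := Polynomial.coeff_of_roots_eq (m.map (eval y)) (eval x t)
    (fun z hz => by
      obtain ⟨x', h1, h2⟩ := hlift y h0 z hz
      rw [← h2, hi h1]) (by rwa [hd])
  rw [hd, Polynomial.leadingCoeff_map_of_leadingCoeff_ne_zero _ hyl, Polynomial.coeff_map] at key
  congr 1
  simp only [map_neg, map_natCast, key]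
  ring

/-- An injective polynomial self-map of affine space over an algebraically closed field of
characteristic zero has a polynomial inverse. -/
theorem exists_aeval_eq_X_of_injective [Finite σ] [IsAlgClosed K] [CharZero K]
    (P : σ → MvPolynomial σ K)
    (hi : Function.Injective fun (x : σ → K) k => eval x (P k)) :
    ∃ Q : σ → MvPolynomial σ K, ∀ i, aeval P (Q i) = X i := by
  have hs := ax_grothendieck_univ P hi
  have hP : AlgebraicIndependent K P := aeval_injective_of_surjective P hs
  suffices h : ∀ t : MvPolynomial σ K, ∃ q, aeval P q = t by
    choose Q hQ using h
    exact ⟨fun i => Q (X i), fun i => hQ _⟩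
  intro t
  obtain ⟨u', v', hu', huv'⟩ := exists_mul_aeval_eq_aeval_of_injective P hP hi t
  obtain ⟨u, v, c, hrel, rfl, rfl⟩ := UniqueFactorizationMonoid.exists_reduced_factors u' hu' v'
  have hc : c ≠ 0 := left_ne_zero_of_mul hu'
  have hu : u ≠ 0 := right_ne_zero_of_mul hu'
  have huv : t * aeval P u = aeval P v := by
    refine mul_left_cancel₀ ((map_ne_zero_iff _ hP).2 hc) ?_
    rw [← map_mul, ← huv', map_mul]
    ring
  by_cases hunit : IsUnit u
  · obtain ⟨w, hw⟩ := hunit.exists_right_inv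
    refine ⟨v * w, ?_⟩
    rw [map_mul, ← huv, mul_assoc, ← map_mul, hw, map_one, mul_one]
  · obtain ⟨π, hπ, hπu⟩ := WfDvdMonoid.exists_irreducible_factor hunit hu
    have hprime : (Ideal.span {π}).IsPrime := (Ideal.span_singleton_prime hπ.ne_zero).2 hπ.prime
    -- Every zero of `π` is some `P(x)`, where `t * u(P) = v(P)` makes `v` vanish.
    have hv : v ∈ Ideal.span {π} := by
      rw [← hprime.radical, ← vanishingIdeal_zeroLocus_eq_radical (K := K), mem_vanishingIdeal_iff]
      intro y hy
      have hy' := hy π (Ideal.mem_span_singleton_self π)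
      rw [aeval_eq_eval] at hy' ⊢
      obtain ⟨x, rfl⟩ := hs y
      have h1 := congrArg (eval x) huv
      obtain ⟨w, rfl⟩ := hπu
      simp only [map_mul, eval_aeval] at h1
      exact h1.symm.trans (by simp [hy'])
    exact absurd (hrel hπu (Ideal.mem_span_singleton.1 hv)) hπ.not_isUnit

end MvPolynomial

/-! ### Functional calculus and derivatives on commuting tuples -/

section commTuples

variable {N : ℕ} {m : Type*} [Fintype m] [DecidableEq m]

open scoped IsMulCommutative in
/-- On a commuting tuple, `matEval` is the evaluation homomorphism. -/
theorem exists_algHom_eq_matEval {X : Fin N → Matrix m m ℂ} (hX : X ∈ commTuples N m) :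
    ∃ φ : MvPolynomial (Fin N) ℂ →ₐ[ℂ] Matrix m m ℂ,
      (∀ i, φ (MvPolynomial.X i) = X i) ∧ ∀ p, φ p = matEval p X := by
  have := Algebra.isMulCommutative_adjoin ℂ (s := Set.range X) (by
    rintro _ ⟨i, rfl⟩ _ ⟨j, rfl⟩
    exact hX i j)
  let x : Fin N → Algebra.adjoin ℂ (Set.range X) := fun i =>
    ⟨X i, Algebra.subset_adjoin ⟨i, rfl⟩⟩
  let φ := (Algebra.adjoin ℂ (Set.range X)).val.comp (MvPolynomial.aeval (R := ℂ) x)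
  have hφ (i) : φ (MvPolynomial.X i) = X i := by simp [φ, x]
  refine ⟨φ, hφ, fun p => ?_⟩
  have hmon (s : Fin N →₀ ℕ) : MvPolynomial.monomial s (1 : ℂ) =
      (List.ofFn fun i => (MvPolynomial.X i : MvPolynomial (Fin N) ℂ) ^ s i).prod := by
    rw [List.prod_ofFn, MvPolynomial.monomial_eq, Finsupp.prod_fintype _ _ (by simp)]
    simp
  conv_lhs => rw [p.as_sum]
  rw [map_sum, matEval]
  refine Finset.sum_congr rfl fun s _ => ?_
  rw [← mul_one (p.coeff s), ← smul_eq_mul, ← MvPolynomial.smul_monomial, map_smul, hmon,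
    map_list_prod, List.map_ofFn]
  simp [Function.comp_def, hφ]

theorem matMap_mem_commTuples (P : Fin N → MvPolynomial (Fin N) ℂ) {X : Fin N → Matrix m m ℂ}
    (hX : X ∈ commTuples N m) : matMap P X ∈ commTuples N m := by
  obtain ⟨φ, -, hφ⟩ := exists_algHom_eq_matEval hX
  intro i j
  simp only [matMap, ← hφ, ← map_mul, mul_comm]

theorem matMap_matMap (P Q : Fin N → MvPolynomial (Fin N) ℂ) {X : Fin N → Matrix m m ℂ}
    (hX : X ∈ commTuples N m) :
    matMap Q (matMap P X) = matMap (fun k => MvPolynomial.aeval P (Q k)) X := by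
  obtain ⟨φ, -, hφ⟩ := exists_algHom_eq_matEval hX
  obtain ⟨ψ, hψX, hψ⟩ := exists_algHom_eq_matEval (matMap_mem_commTuples P hX)
  have h : ψ = φ.comp (MvPolynomial.aeval P) := by
    ext i : 1
    simp [hψX, matMap, hφ]
  ext1 k
  change matEval (Q k) (matMap P X) = matEval _ X
  rw [← hψ, ← hφ, h, AlgHom.comp_apply]

theorem matMap_X {X : Fin N → Matrix m m ℂ} (hX : X ∈ commTuples N m) :
    matMap MvPolynomial.X X = X := by
  obtain ⟨φ, hφX, hφ⟩ := exists_algHom_eq_matEval hX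
  ext1 k
  rw [matMap, ← hφ, hφX]

theorem leftInvOn_matMap {P Q : Fin N → MvPolynomial (Fin N) ℂ}
    (h : Function.LeftInverse (scalarMap Q) (scalarMap P)) :
    Set.LeftInvOn (matMap Q) (matMap P) (commTuples N m) := by
  intro X hX
  rw [matMap_matMap P Q hX]
  convert! matMap_X hX using 2
  ext1 k
  refine MvPolynomial.funext fun x => ?_
  rw [MvPolynomial.eval_aeval, MvPolynomial.eval_X]
  exact congrFun (h x) k

theorem invOn_matMap {P Q : Fin N → MvPolynomial (Fin N) ℂ}
    (h : Function.LeftInverse (scalarMap Q) (scalarMap P))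
    (h' : Function.RightInverse (scalarMap Q) (scalarMap P)) :
    Set.InvOn (matMap Q) (matMap P) (commTuples N m) (commTuples N m) :=
  ⟨leftInvOn_matMap h, leftInvOn_matMap h'⟩

theorem matEval_toBlocks {X H : Fin N → Matrix m m ℂ} (hX : X ∈ commTuples N m)
    (hH : H ∈ tangentDirs X) (p : MvPolynomial (Fin N) ℂ) :
    matEval p (blockTuple X H) =
      Matrix.fromBlocks (matEval p X) (matEval p (blockTuple X H)).toBlocks₁₂ 0 (matEval p X) := by
  obtain ⟨φ, hφX, hφ⟩ := exists_algHom_eq_matEval hX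
  obtain ⟨ψ, hψX, hψ⟩ := exists_algHom_eq_matEval hH
  have h : ∃ K, ψ p = Matrix.fromBlocks (φ p) K 0 (φ p) := by
    induction p using MvPolynomial.induction_on with
    | C a =>
      refine ⟨0, ?_⟩
      change ψ (algebraMap ℂ _ a) =
        Matrix.fromBlocks (φ (algebraMap ℂ _ a)) _ _ (φ (algebraMap ℂ _ a))
      rw [AlgHom.commutes, AlgHom.commutes, Algebra.algebraMap_eq_smul_one,
        Algebra.algebraMap_eq_smul_one, ← Matrix.fromBlocks_one, Matrix.fromBlocks_smul]
      simp
    | add p q hp hq =>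
      obtain ⟨K, hK⟩ := hp
      obtain ⟨L, hL⟩ := hq
      exact ⟨K + L, by rw [map_add, hK, hL, Matrix.fromBlocks_add, map_add, add_zero]⟩
    | mul_X p i hp =>
      obtain ⟨K, hK⟩ := hp
      -- The Leibniz rule.
      refine ⟨φ p * H i + K * X i, ?_⟩
      rw [map_mul, hK, hψX, blockTuple, Matrix.fromBlocks_multiply, map_mul, hφX]
      simp
  obtain ⟨K, hK⟩ := h
  rw [← hψ, ← hφ, hK, Matrix.toBlocks_fromBlocks₁₂]

theorem matMap_blockTuple (P : Fin N → MvPolynomial (Fin N) ℂ) {X H : Fin N → Matrix m m ℂ}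
    (hX : X ∈ commTuples N m) (hH : H ∈ tangentDirs X) :
    matMap P (blockTuple X H) = blockTuple (matMap P X) (freeDeriv P X H) :=
  funext fun k => matEval_toBlocks hX hH (P k)

theorem freeDeriv_mem_tangentDirs (P : Fin N → MvPolynomial (Fin N) ℂ) {X H : Fin N → Matrix m m ℂ}
    (hX : X ∈ commTuples N m) (hH : H ∈ tangentDirs X) :
    freeDeriv P X H ∈ tangentDirs (matMap P X) := by
  change blockTuple _ _ ∈ commTuples _ _
  rw [← matMap_blockTuple P hX hH]
  exact matMap_mem_commTuples P hH

/-- The chain rule: apply `Q ∘ P = id` to the block tuple and read off its corner. -/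
theorem freeDeriv_freeDeriv {P Q : Fin N → MvPolynomial (Fin N) ℂ}
    (h : Function.LeftInverse (scalarMap Q) (scalarMap P)) {X H : Fin N → Matrix m m ℂ}
    (hX : X ∈ commTuples N m) (hH : H ∈ tangentDirs X) :
    freeDeriv Q (matMap P X) (freeDeriv P X H) = H := by
  ext1 k
  rw [freeDeriv, ← matMap_blockTuple P hX hH, leftInvOn_matMap h hH, blockTuple,
    Matrix.toBlocks_fromBlocks₁₂]

theorem bijOn_freeDeriv {P Q : Fin N → MvPolynomial (Fin N) ℂ}
    (h : Function.LeftInverse (scalarMap Q) (scalarMap P))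
    (h' : Function.RightInverse (scalarMap Q) (scalarMap P)) {X : Fin N → Matrix m m ℂ}
    (hX : X ∈ commTuples N m) :
    Set.BijOn (freeDeriv P X) (tangentDirs X) (tangentDirs (matMap P X)) := by
  have hPX := matMap_mem_commTuples P hX
  have hQP : matMap Q (matMap P X) = X := leftInvOn_matMap h hX
  refine Set.InvOn.bijOn (f' := freeDeriv Q (matMap P X))
    ⟨fun H hH => freeDeriv_freeDeriv h hX hH, fun H hH => ?_⟩
    (fun H hH => freeDeriv_mem_tangentDirs P hX hH) (fun H hH => ?_)
  · have := freeDeriv_freeDeriv h' hPX hH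
    rwa [hQP] at this
  · have := freeDeriv_mem_tangentDirs Q hPX hH
    rwa [hQP] at this

theorem zero_mem_tangentDirs {X : Fin N → Matrix m m ℂ} (hX : X ∈ commTuples N m) :
    (0 : Fin N → Matrix m m ℂ) ∈ tangentDirs X := by
  intro i j
  simp [blockTuple, Matrix.fromBlocks_multiply, hX i j]

theorem freeDeriv_zero (P : Fin N → MvPolynomial (Fin N) ℂ) {X : Fin N → Matrix m m ℂ}
    (hX : X ∈ commTuples N m) : freeDeriv P X 0 = 0 := by
  obtain ⟨ψ, hψX, hψ⟩ := exists_algHom_eq_matEval (zero_mem_tangentDirs hX)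
  ext1 k
  change (matEval (P k) _).toBlocks₁₂ = 0
  have h := matEval_toBlocks hX (zero_mem_tangentDirs hX)
  rw [← hψ]
  induction P k using MvPolynomial.induction_on with
  | C a =>
    change (ψ (algebraMap ℂ _ a)).toBlocks₁₂ = 0
    rw [AlgHom.commutes, Algebra.algebraMap_eq_smul_one, ← Matrix.fromBlocks_one,
      Matrix.fromBlocks_smul, Matrix.toBlocks_fromBlocks₁₂, smul_zero]
  | add p q hp hq =>
    rw [map_add]
    exact congrArg₂ (· + ·) hp hq |>.trans (add_zero 0)
  | mul_X p i hp =>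
    rw [map_mul, hψX, hψ, h, ← hψ, hp, blockTuple, Matrix.fromBlocks_multiply,
      Matrix.toBlocks_fromBlocks₁₂]
    simp

/-! ### From small matrices back to points -/

theorem injective_scalarMap_of_injOn {P : Fin N → MvPolynomial (Fin N) ℂ}
    (h : Set.InjOn (matMap P) (commTuples N (Fin 1))) : Function.Injective (scalarMap P) := by
  let D (x : Fin N → ℂ) : Fin N → Matrix (Fin 1) (Fin 1) ℂ := fun i => algebraMap ℂ _ (x i)
  have hD (x) : D x ∈ commTuples N (Fin 1) := fun i j => Algebra.commutes _ _
  have hinj := (algebraMap ℂ (Matrix (Fin 1) (Fin 1) ℂ)).injective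
  have hP (x) : matMap P (D x) = D (scalarMap P x) := by
    obtain ⟨φ, hφX, hφ⟩ := exists_algHom_eq_matEval (hD x)
    have : φ = (Algebra.ofId ℂ _).comp (MvPolynomial.aeval x) := by
      ext i : 1
      simp [hφX, D, Algebra.ofId_apply]
    ext1 k
    rw [matMap, ← hφ, this]
    simp [D, Algebra.ofId_apply, scalarMap, MvPolynomial.aeval_eq_eval]
  intro x y hxy
  have := h (hD x) (hD y) (by rw [hP, hP, hxy])
  exact funext fun i => hinj (congrFun this i)

theorem injective_scalarMap_of_freeDeriv {P : Fin N → MvPolynomial (Fin N) ℂ}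
    (h : ∀ X ∈ commTuples N (Fin 2), ∀ H ∈ tangentDirs X, freeDeriv P X H = 0 → H = 0) :
    Function.Injective (scalarMap P) := by
  intro x y hxy
  let D (a b : ℂ) : Matrix (Fin 2) (Fin 2) ℂ := !![a, 0; 0, b]
  let E (a : ℂ) : Matrix (Fin 2) (Fin 2) ℂ := !![0, a; 0, 0]
  let X : Fin N → Matrix (Fin 2) (Fin 2) ℂ := fun i => D (x i) (y i)
  let H : Fin N → Matrix (Fin 2) (Fin 2) ℂ := fun i => E (x i - y i)
  have hDD (a b c d) : D a b * D c d = D (a * c) (b * d) := by simp [D]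
  have hDE (a b c) : D a b * E c = E (a * c) := by simp [D, E]
  have hED (a b c) : E c * D a b = E (c * b) := by
    ext i j; fin_cases i <;> fin_cases j <;> simp [D, E]
  have hEE (a b) : E a + E b = E (a + b) := by simp [E]
  have hDa (a b c d) : D a b + D c d = D (a + c) (b + d) := by simp [D]
  have hX : X ∈ commTuples N (Fin 2) := fun i j => by simp only [X, hDD, mul_comm]
  -- Both corners equal `x i * x j - y i * y j`.
  have hH : H ∈ tangentDirs X := fun i j => by
    simp only [blockTuple, X, H, Matrix.fromBlocks_multiply, hDD, hDE, hED, hEE, mul_zero, zero_mul,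
      add_zero, zero_add, mul_comm (x i), mul_comm (y i)]
    congr 2
    ring
  obtain ⟨φ, hφX, hφ⟩ := exists_algHom_eq_matEval hH
  have key (p : MvPolynomial (Fin N) ℂ) : φ p = Matrix.fromBlocks
      (D (p.eval x) (p.eval y)) (E (p.eval x - p.eval y)) 0 (D (p.eval x) (p.eval y)) := by
    induction p using MvPolynomial.induction_on with
    | C a =>
      have hD : D a a = a • 1 := by ext i j; fin_cases i <;> fin_cases j <;> simp [D]
      have hE : E 0 = 0 := by ext i j; fin_cases i <;> fin_cases j <;> simp [E]
      rw [MvPolynomial.eval_C, MvPolynomial.eval_C, sub_self, hD, hE, ← smul_zero a,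
        ← Matrix.fromBlocks_smul, Matrix.fromBlocks_one, ← Algebra.algebraMap_eq_smul_one]
      exact φ.commutes a
    | add p q hp hq =>
      rw [map_add, hp, hq, Matrix.fromBlocks_add, hDa, hEE, add_zero, map_add, map_add,
        add_sub_add_comm]
    | mul_X p i hp =>
      rw [map_mul, hp, hφX, blockTuple, Matrix.fromBlocks_multiply]
      simp only [X, H, hDD, hDE, hED, hEE, mul_zero, zero_mul, add_zero, zero_add, map_mul,
        MvPolynomial.eval_X]
      congr 2
      ring
  have h0 : freeDeriv P X H = 0 := by
    ext1 k
    have := congrFun hxy k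
    simp only [scalarMap] at this
    rw [freeDeriv, matMap, ← hφ, key, Matrix.toBlocks_fromBlocks₁₂, this, sub_self]
    ext i j
    fin_cases i <;> fin_cases j <;> simp [E]
  ext i
  have := congrFun (congrFun (congrFun (h X hX H hH h0) i) 0) 1
  simpa [H, E, sub_eq_zero] using this

end commTuples

/-! ### The equivalences -/

theorem mainTheorem4 (N : ℕ) (P : Fin N → MvPolynomial (Fin N) ℂ) :
    List.TFAE [
      -- `DP(X)` is nonsingular (has trivial kernel) at each commuting tuple `X`
      ∀ n : ℕ, ∀ X ∈ commTuples N (Fin n), ∀ H ∈ tangentDirs X, freeDeriv P X H = 0 → H = 0,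
      -- `DP(X)` is even a bijection between the spaces of directions at `X` and at `P(X)`
      ∀ n : ℕ, ∀ X ∈ commTuples N (Fin n),
        Set.BijOn (freeDeriv P X) (tangentDirs X) (tangentDirs (matMap P X)),
      -- `P` is injective on commuting tuples
      ∀ n : ℕ, Set.InjOn (matMap P) (commTuples N (Fin n)),
      -- `P` is a bijection of the commuting tuples
      ∀ n : ℕ, Set.BijOn (matMap P) (commTuples N (Fin n)) (commTuples N (Fin n)),
      -- one polynomial map inverts `P` on the commuting tuples of all sizes
      ∃ Q : Fin N → MvPolynomial (Fin N) ℂ, ∀ n : ℕ,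
        Set.InvOn (matMap Q) (matMap P) (commTuples N (Fin n)) (commTuples N (Fin n)),
      -- the same three conditions on `ℂ^N`
      Function.Injective (scalarMap P),
      Function.Bijective (scalarMap P),
      ∃ Q : Fin N → MvPolynomial (Fin N) ℂ,
        Function.LeftInverse (scalarMap Q) (scalarMap P) ∧
          Function.RightInverse (scalarMap Q) (scalarMap P)] := by
  tfae_have 8 → 2 := fun ⟨Q, h, h'⟩ n X hX => bijOn_freeDeriv h h' hX
  tfae_have 2 → 1 := fun h n X hX H hH h0 =>
    (h n X hX).injOn hH (zero_mem_tangentDirs hX) (h0.trans (freeDeriv_zero P hX).symm)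
  tfae_have 1 → 6 := fun h => injective_scalarMap_of_freeDeriv (h 2)
  tfae_have 8 → 5 := fun ⟨Q, h, h'⟩ => ⟨Q, fun n => invOn_matMap h h'⟩
  tfae_have 5 → 4 := fun ⟨Q, h⟩ n => (h n).bijOn
    (fun _ hX => matMap_mem_commTuples P hX) (fun _ hX => matMap_mem_commTuples Q hX)
  tfae_have 4 → 3 := fun h n => (h n).injOn
  tfae_have 3 → 6 := fun h => injective_scalarMap_of_injOn (h 1)
  tfae_have 8 → 7 := fun ⟨Q, h, h'⟩ => ⟨h.injective, h'.surjective⟩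
  tfae_have 7 → 6 := fun h => h.injective
  tfae_have 6 → 8 := fun h => by
    obtain ⟨Q, hQ⟩ := MvPolynomial.exists_aeval_eq_X_of_injective P h
    have hl : Function.LeftInverse (scalarMap Q) (scalarMap P) := fun x => funext fun i => by
      have := congrArg (MvPolynomial.eval x) (hQ i)
      rwa [MvPolynomial.eval_aeval, MvPolynomial.eval_X] at this
    exact ⟨Q, hl, hl.rightInverse_of_surjective (ax_grothendieck_univ P h)⟩
  tfae_finish
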